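/- Let $M$ be a smooth manifold of dimension $2n+1$ with a $(1,1)$-tensor field $\varphi$, a vector field $\xi$, a 1-form $\eta$ and a Riemannian or pseudo-Riemannian metric $g$, all smooth, and let $\varepsilon_0,\varepsilon_1\in\{1,-1\}$. Assume that $$\varphi^2X=\varepsilon_1(X-\eta(X)\xi),\qquad \eta(\xi)=1,\qquad g(\varphi X,\varphi Y)=-\varepsilon_1\bigl(g(X,Y)-\varepsilon_0\,\eta(X)\eta(Y)\bigr),$$ and that $(\varphi,\xi,\eta,g)$ is (para)contact metric, i.e. $\varPhi=d\eta$, where $\varPhi(X,Y)=g(X,\varphi Y)$ and $d\eta(X,Y)=\tfrac12\bigl(X(\eta(Y))-Y(\eta(X))-\eta([X,Y])\bigr)$. Let $\nabla$ be the Levi-Civita connection of $g$, $R(X,Y)Z=\nabla_X\nabla_YZ-\nabla_Y\nabla_XZ-\nabla_{[X,Y]}Z$, $R(X,Y,Z,W)=g(R(X,Y)Z,W)$, and $h=\tfrac12\mathcal L_\xi\varphi$, i.e. $hX=\tfrac12([\xi,\varphi X]-\varphi[\xi,X])$. Then for all smooth vector fields $X,Y,Z$ on $M$, $$R(\xi,X)\xi+\varepsilon_1\,\varphi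 R(\xi,\varphi X)\xi=2\varphi^2X-2\varepsilon_1h^2X,$$ and $$\begin{aligned}&-\varepsilon_1R(\xi,X,Y,Z)-R(\xi,X,\varphi Y,\varphi Z)+R(\xi,\varphi X,\varphi Y,Z)+R(\xi,\varphi X,Y,\varphi Z)\\&\quad=2(\nabla_{hX}\varPhi)(Y,Z)-2\varepsilon_0\,g(\varepsilon_0X-\varepsilon_1hX,Z)\,\eta(Y)+2\varepsilon_0\,g(\varepsilon_0X-\varepsilon_1hX,Y)\,\eta(Z).\end{aligned}$$ -/

import Mathlib

open scoped Manifold ContDiff Bundle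

noncomputable section

namespace ParaContact

open VectorField

variable {E : Type*} [NormedAddCommGroup E] [NormedSpace ℝ E] [FiniteDimensional ℝ E]
  {H : Type*} [TopologicalSpace H] {I : ModelWithCorners ℝ E H}
  {M : Type*} [TopologicalSpace M] [ChartedSpace H M] [IsManifold I ∞ M]

variable (I) in
/-- A smooth vector field on `M`. -/
def IsSmoothVectorField (X : Π x : M, TangentSpace I x) : Prop :=
  ContMDiff I (I.prod 𝓘(ℝ, E)) ∞ (fun x ↦ Bundle.TotalSpace.mk' E x (X x))

variable (I M) in
/-- A smooth Riemannian or pseudo-Riemannian metric on `M`: a smooth field of symmetric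
nondegenerate bilinear forms on the tangent spaces, of arbitrary signature. -/
structure PseudoMetric where
  /-- The bilinear form on the tangent space at `x`. -/
  val (x : M) : TangentSpace I x →L[ℝ] TangentSpace I x →L[ℝ] ℝ
  symm (x : M) (v w : TangentSpace I x) : val x v w = val x w v
  nondegenerate (x : M) (v : TangentSpace I x) (hv : ∀ w, val x v w = 0) : v = 0
  contMDiff : ContMDiff I (I.prod 𝓘(ℝ, E →L[ℝ] E →L[ℝ] ℝ)) ∞
    (fun x ↦ Bundle.TotalSpace.mk' (E →L[ℝ] E →L[ℝ] ℝ) x (val x))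

namespace PseudoMetric

variable (g : PseudoMetric I M)

/-- The function `g(X, Y)` on `M`. -/
def pairing (X Y : Π x : M, TangentSpace I x) (x : M) : ℝ := g.val x (X x) (Y x)

lemma mdifferentiableAt_pairing {X Y : Π x : M, TangentSpace I x} {x : M}
    (hX : MDiffAt (T% X) x) (hY : MDiffAt (T% Y) x) :
    MDifferentiableAt I 𝓘(ℝ, ℝ) (g.pairing X Y) x := by
  have hg := g.contMDiff.mdifferentiable (by simp) x
  have := hg.clm_bundle_apply₂ (F₁ := E) (F₂ := E) (F₃ := ℝ) (E₃ := Bundle.Trivial M ℝ) hX hY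
  rw [mdifferentiableAt_totalSpace] at this
  exact this.2

/-- The right-hand side of the Koszul formula, equal to `2 g(∇_X Y, Z)`. -/
def koszul (X Y Z : Π x : M, TangentSpace I x) (x : M) : ℝ :=
  mvfderiv I (g.pairing Y Z) x (X x) + mvfderiv I (g.pairing X Z) x (Y x)
    - mvfderiv I (g.pairing X Y) x (Z x)
    + g.val x (mlieBracket I X Y x) (Z x) - g.val x (mlieBracket I X Z x) (Y x)
    - g.val x (mlieBracket I Y Z x) (X x)

lemma mvfderiv_pairing_add_left {X X' Y : Π x : M, TangentSpace I x} {x : M}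
    (hX : MDiffAt (T% X) x) (hX' : MDiffAt (T% X') x) (hY : MDiffAt (T% Y) x) :
    mvfderiv I (g.pairing (X + X') Y) x
      = mvfderiv I (g.pairing X Y) x + mvfderiv I (g.pairing X' Y) x := by
  rw [← mvfderiv_add (g.mdifferentiableAt_pairing hX hY) (g.mdifferentiableAt_pairing hX' hY)]
  congr 1
  ext y
  simp [pairing]

lemma mvfderiv_pairing_smul_left {f : M → ℝ} {X Y : Π x : M, TangentSpace I x} {x : M}
    (hf : MDifferentiableAt I 𝓘(ℝ, ℝ) f x) (hX : MDiffAt (T% X) x) (hY : MDiffAt (T% Y) x) :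
    mvfderiv I (g.pairing (f • X) Y) x
      = f x • mvfderiv I (g.pairing X Y) x + g.pairing X Y x • mvfderiv I f x := by
  rw [← mvfderiv_mul hf (g.mdifferentiableAt_pairing hX hY)]
  congr 1
  ext y
  simp [pairing]

lemma pairing_comm (X Y : Π x : M, TangentSpace I x) : g.pairing X Y = g.pairing Y X :=
  funext fun x ↦ g.symm x _ _

lemma mvfderiv_pairing_add_right {X Y Y' : Π x : M, TangentSpace I x} {x : M}
    (hX : MDiffAt (T% X) x) (hY : MDiffAt (T% Y) x) (hY' : MDiffAt (T% Y') x) :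
    mvfderiv I (g.pairing X (Y + Y')) x
      = mvfderiv I (g.pairing X Y) x + mvfderiv I (g.pairing X Y') x := by
  rw [g.pairing_comm X, g.pairing_comm X, g.pairing_comm X, g.mvfderiv_pairing_add_left hY hY' hX]

lemma mvfderiv_pairing_smul_right {f : M → ℝ} {X Y : Π x : M, TangentSpace I x} {x : M}
    (hf : MDifferentiableAt I 𝓘(ℝ, ℝ) f x) (hX : MDiffAt (T% X) x) (hY : MDiffAt (T% Y) x) :
    mvfderiv I (g.pairing X (f • Y)) x
      = f x • mvfderiv I (g.pairing X Y) x + g.pairing X Y x • mvfderiv I f x := by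
  rw [g.pairing_comm X, g.pairing_comm X, g.mvfderiv_pairing_smul_left hf hY hX]

lemma koszul_tensorial_left {Y Z : Π x : M, TangentSpace I x} {x : M}
    (hY : MDiffAt (T% Y) x) (hZ : MDiffAt (T% Z) x) :
    TensorialAt I E (fun X ↦ g.koszul X Y Z x) x where
  smul {f X} hf hX := by
    have := FiniteDimensional.complete ℝ E
    simp only [koszul, g.mvfderiv_pairing_smul_left hf hX hY, g.mvfderiv_pairing_smul_left hf hX hZ,
      mlieBracket_smul_left hf hX]
    simp [pairing]
    ring
  add {X X'} hX hX' := by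
    have := FiniteDimensional.complete ℝ E
    simp only [koszul, g.mvfderiv_pairing_add_left hX hX' hY, g.mvfderiv_pairing_add_left hX hX' hZ,
      mlieBracket_add_left hX hX']
    simp
    ring

lemma koszul_tensorial_right {X Y : Π x : M, TangentSpace I x} {x : M}
    (hX : MDiffAt (T% X) x) (hY : MDiffAt (T% Y) x) :
    TensorialAt I E (fun Z ↦ g.koszul X Y Z x) x where
  smul {f Z} hf hZ := by
    have := FiniteDimensional.complete ℝ E
    simp only [koszul, g.mvfderiv_pairing_smul_right hf hY hZ,
      g.mvfderiv_pairing_smul_right hf hX hZ, mlieBracket_smul_right hf hZ]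
    simp [pairing, g.symm x (Z x)]
    ring
  add {Z Z'} hZ hZ' := by
    have := FiniteDimensional.complete ℝ E
    simp only [koszul, g.mvfderiv_pairing_add_right hY hZ hZ',
      g.mvfderiv_pairing_add_right hX hZ hZ', mlieBracket_add_right hZ hZ']
    simp
    ring

/-- The linear isomorphism `v ↦ g(v, ·)` from a tangent space to its dual. -/
def flat (x : M) : TangentSpace I x ≃L[ℝ] (TangentSpace I x →L[ℝ] ℝ) :=
  have : FiniteDimensional ℝ (TangentSpace I x) := inferInstanceAs (FiniteDimensional ℝ E)
  have : T2Space (TangentSpace I x) := inferInstanceAs (T2Space E)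
  have hdim : Module.finrank ℝ (TangentSpace I x)
      = Module.finrank ℝ (TangentSpace I x →L[ℝ] ℝ) := by
    rw [← (LinearMap.toContinuousLinearMap (𝕜 := ℝ) (E := TangentSpace I x)
      (F' := ℝ)).finrank_eq]
    exact (Subspace.dual_finrank_eq).symm
  (LinearMap.linearEquivOfInjective (g.val x).toLinearMap
    ((injective_iff_map_eq_zero _).2 fun v hv ↦ g.nondegenerate x v fun w ↦ congr($hv w))
    hdim).toContinuousLinearEquiv

lemma flat_apply (x : M) (v : TangentSpace I x) : g.flat x v = g.val x v := rfl

open Classical in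
/-- The operator underlying the Levi-Civita connection: `leviCivitaAux g Y x u` is the vector
`∇_u Y` at `x` that is determined by the Koszul formula `2 g(∇_X Y, Z) = koszul g X Y Z`. -/
def leviCivitaAux (Y : Π x : M, TangentSpace I x) (x : M) :
    TangentSpace I x →L[ℝ] TangentSpace I x :=
  if hY : MDiffAt (T% Y) x then
    (1 / 2 : ℝ) • ((g.flat x).symm : (TangentSpace I x →L[ℝ] ℝ) →L[ℝ] TangentSpace I x) ∘L
      TensorialAt.mkHom₂ (F := E) (F' := E) (fun X Z ↦ g.koszul X Y Z x) x
        (fun _ hZ ↦ g.koszul_tensorial_left hY hZ) (fun _ hX ↦ g.koszul_tensorial_right hX hY)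
  else 0

/-- The Koszul formula. -/
lemma two_mul_leviCivitaAux {X Y Z : Π x : M, TangentSpace I x} {x : M}
    (hX : MDiffAt (T% X) x) (hY : MDiffAt (T% Y) x) (hZ : MDiffAt (T% Z) x) :
    2 * g.val x (g.leviCivitaAux Y x (X x)) (Z x) = g.koszul X Y Z x := by
  rw [leviCivitaAux, dif_pos hY, ← flat_apply]
  have := TensorialAt.mkHom₂_apply (F := E) (F' := E) (Φ := fun X Z ↦ g.koszul X Y Z x)
    (fun _ hZ ↦ g.koszul_tensorial_left hY hZ) (fun _ hX ↦ g.koszul_tensorial_right hX hY) hX hZ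
  simp [this]

/-- Two tangent vectors with the same Koszul pairings against differentiable fields agree. -/
lemma clm_ext_of_pairing {x : M} {A B : TangentSpace I x →L[ℝ] TangentSpace I x}
    (h : ∀ X Z : Π x : M, TangentSpace I x, MDiffAt (T% X) x → MDiffAt (T% Z) x →
      2 * g.val x (A (X x)) (Z x) = 2 * g.val x (B (X x)) (Z x)) : A = B := by
  ext u
  refine sub_eq_zero.1 (g.nondegenerate x _ fun w ↦ ?_)
  have := h (FiberBundle.extend E u) (FiberBundle.extend E w)
    (FiberBundle.mdifferentiableAt_extend ..) (FiberBundle.mdifferentiableAt_extend ..)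
  simp only [FiberBundle.extend_apply_self] at this
  simp
  linarith

/-- The Levi-Civita connection of a pseudo-Riemannian metric. -/
def leviCivita : CovariantDerivative I E (TangentSpace I : M → Type _) where
  toFun := g.leviCivitaAux
  isCovariantDerivativeOnUniv :=
    { add := by
        intro Y Y' x hY hY' _
        have := FiniteDimensional.complete ℝ E
        have hYY' := mdifferentiableAt_add_section hY hY'
        refine g.clm_ext_of_pairing fun X Z hX hZ ↦ ?_
        rw [g.two_mul_leviCivitaAux hX hYY' hZ]
        simp only [add_apply, map_add, mul_add,
          g.two_mul_leviCivitaAux hX hY hZ, g.two_mul_leviCivitaAux hX hY' hZ]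
        simp only [koszul, g.mvfderiv_pairing_add_left hY hY' hZ,
          g.mvfderiv_pairing_add_right hX hY hY', mlieBracket_add_left hY hY',
          mlieBracket_add_right hY hY']
        simp
        ring
      leibniz := by
        intro Y f x hY hf _
        have := FiniteDimensional.complete ℝ E
        have hfY := hf.smul_section hY
        refine g.clm_ext_of_pairing fun X Z hX hZ ↦ ?_
        rw [g.two_mul_leviCivitaAux hX hfY hZ]
        have h1 := g.two_mul_leviCivitaAux hX hY hZ
        simp only [add_apply, smul_apply, map_add,
          map_smul, smul_eq_mul, ContinuousLinearMap.smulRight_apply]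
        rw [mul_add, mul_left_comm, h1]
        simp only [koszul, g.mvfderiv_pairing_smul_left hf hY hZ,
          g.mvfderiv_pairing_smul_right hf hX hY, mlieBracket_smul_left hf hY,
          mlieBracket_smul_right hf hY]
        simp [pairing, g.symm x (Y x)]
        ring }

/-- The covariant derivative `∇_X Y` of vector fields for the Levi-Civita connection. -/
def nabla (X Y : Π x : M, TangentSpace I x) (x : M) : TangentSpace I x :=
  g.leviCivita Y x (X x)

/-- The curvature operator `R(X, Y)Z = ∇_X ∇_Y Z - ∇_Y ∇_X Z - ∇_{[X, Y]} Z`. -/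
def curvature (X Y Z : Π x : M, TangentSpace I x) (x : M) : TangentSpace I x :=
  g.nabla X (g.nabla Y Z) x - g.nabla Y (g.nabla X Z) x - g.nabla (mlieBracket I X Y) Z x

/-- The curvature tensor of type `(0, 4)`, `R(X, Y, Z, W) = g(R(X, Y)Z, W)`. -/
def curvature4 (X Y Z W : Π x : M, TangentSpace I x) (x : M) : ℝ :=
  g.val x (g.curvature X Y Z x) (W x)

end PseudoMetric

/-- The exterior derivative of a 1-form `η`, normalised by
`dη(X, Y) = (X(η(Y)) - Y(η(X)) - η([X, Y])) / 2`. -/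
def extDerivOneForm (η : Π x : M, TangentSpace I x →L[ℝ] ℝ) (X Y : Π x : M, TangentSpace I x)
    (x : M) : ℝ :=
  (1 / 2) * (mvfderiv I (fun y ↦ η y (Y y)) x (X x) - mvfderiv I (fun y ↦ η y (X y)) x (Y x)
    - η x (mlieBracket I X Y x))

variable (I M) in
/-- An almost (para)contact metric structure `(φ, ξ, η, g)` with signs `ε₀`, `ε₁`
on the manifold `M`. -/
structure AlmostParaContactMetric (ε₀ ε₁ : ℝ) where
  /-- The tensor field of type `(1, 1)`. -/
  φ (x : M) : TangentSpace I x →L[ℝ] TangentSpace I x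
  /-- The characteristic vector field. -/
  ξ (x : M) : TangentSpace I x
  /-- The 1-form. -/
  η (x : M) : TangentSpace I x →L[ℝ] ℝ
  /-- The Riemannian or pseudo-Riemannian metric. -/
  g : PseudoMetric I M
  φ_smooth : ContMDiff I (I.prod 𝓘(ℝ, E →L[ℝ] E)) ∞
    (fun x ↦ Bundle.TotalSpace.mk' (E →L[ℝ] E)
      (E := fun x : M ↦ TangentSpace I x →L[ℝ] TangentSpace I x) x (φ x))
  ξ_smooth : IsSmoothVectorField I ξ
  η_smooth : ContMDiff I (I.prod 𝓘(ℝ, E →L[ℝ] ℝ)) ∞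
    (fun x ↦ Bundle.TotalSpace.mk' (E →L[ℝ] ℝ)
      (E := fun x : M ↦ TangentSpace I x →L[ℝ] Bundle.Trivial M ℝ x) x (η x))
  φ_sq (x : M) (v : TangentSpace I x) : φ x (φ x v) = ε₁ • (v - η x v • ξ x)
  η_ξ (x : M) : η x (ξ x) = 1
  compat (x : M) (v w : TangentSpace I x) :
    g.val x (φ x v) (φ x w) = -ε₁ * (g.val x v w - ε₀ * (η x v * η x w))

namespace AlmostParaContactMetric

variable {ε₀ ε₁ : ℝ} (S : AlmostParaContactMetric I M ε₀ ε₁)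

/-- The vector field `φX`. -/
def phi (X : Π x : M, TangentSpace I x) (x : M) : TangentSpace I x := S.φ x (X x)

/-- The fundamental form `Φ(X, Y) = g(X, φY)`. -/
def fundamentalForm (X Y : Π x : M, TangentSpace I x) (x : M) : ℝ :=
  S.g.val x (X x) (S.φ x (Y x))

/-- The structure is (para)contact metric: `Φ = dη`. -/
def IsParaContactMetric : Prop :=
  ∀ (x : M) (X Y : Π x : M, TangentSpace I x), MDiffAt (T% X) x → MDiffAt (T% Y) x →
    S.fundamentalForm X Y x = extDerivOneForm S.η X Y x

/-- The operator `h = (1/2) L_ξ φ`, that is, `hX = ([ξ, φX] - φ[ξ, X]) / 2`. -/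
def h (X : Π x : M, TangentSpace I x) (x : M) : TangentSpace I x :=
  (1 / 2 : ℝ) • (mlieBracket I S.ξ (S.phi X) x - S.φ x (mlieBracket I S.ξ X x))

/-- The covariant derivative `(∇_X Φ)(Y, Z)` of the fundamental form. -/
def nablaFundamentalForm (X Y Z : Π x : M, TangentSpace I x) (x : M) : ℝ :=
  mvfderiv I (S.fundamentalForm Y Z) x (X x)
    - S.fundamentalForm (S.g.nabla X Y) Z x - S.fundamentalForm Y (S.g.nabla X Z) x

end AlmostParaContactMetric

end ParaContact

end

/-! Write A for the endomorphism v ↦ ∇_v ξ (`nablaξ`). Three consequences of Φ = dη carry the proof.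
The skew part of A is a multiple of φ (`val_nablaξ_sub`). Closedness of Φ with ξ in one slot,
combined with the derivative of φ² = ε₁(1 - η ⊗ ξ), forces ∇_ξ φ = 0 and Aφ + φA = -2ε₀φ²
(`nablaξ_φ`, `nablaPhi_ξ_left`), so that h = φA + ε₀φ² (`h_apply`). Closedness with φ inserted in
the arguments expresses T(X, Y) = φ(∇_X φ)Y + (∇_{φX} φ)Y algebraically in φ, ξ, η, g and A
(`phi_nablaPhi_add`).

First identity: Aξ = 0 gives R(ξ, X)ξ = (∇_ξ A)X + A²X. Differentiating φAφ = -ε₁(A + 2ε₀φ) along ξ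
gives φ(∇_ξ A)φ = -ε₁ ∇_ξ A, so the derivative terms cancel and both sides equal 2A²X.

Second identity: the commutator of R(ξ, X) with φ is a ξ-derivative of ∇φ (`curvature_ξ_phi`).
Adding φ of this commutator to the one for φX produces the ξ-derivative of T; since L_ξ φ = 2h, a
term -2(∇_{hX} φ)Y is left over. After pairing with Z, the ξ-part of φ² contributes g(R(ξ, X)ξ,
Y)η(Z), whose derivative part cancels because ∇_ξ A is self-adjoint (`val_nabla_ξ_nablaξ_comm`). -/

noncomputable section

namespace ParaContact

open VectorField

variable {E : Type*} [NormedAddCommGroup E] [NormedSpace ℝ E] [FiniteDimensional ℝ E]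
  {H : Type*} [TopologicalSpace H] {I : ModelWithCorners ℝ E H}
  {M : Type*} [TopologicalSpace M] [ChartedSpace H M] [IsManifold I ∞ M]

/-! ### Smooth vector fields, global extensions and brackets. -/

namespace IsSmoothVectorField

variable {X Y : Π x : M, TangentSpace I x} {f : M → ℝ}

omit [FiniteDimensional ℝ E] in
lemma mdifferentiableAt (hX : IsSmoothVectorField I X) (x : M) : MDiffAt (T% X) x :=
  ContMDiff.mdifferentiable hX (by simp) x

omit [FiniteDimensional ℝ E] in
lemma add (hX : IsSmoothVectorField I X) (hY : IsSmoothVectorField I Y) :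
    IsSmoothVectorField I (X + Y) :=
  ContMDiff.add_section hX hY

omit [FiniteDimensional ℝ E] in
lemma sub (hX : IsSmoothVectorField I X) (hY : IsSmoothVectorField I Y) :
    IsSmoothVectorField I (X - Y) :=
  ContMDiff.sub_section hX hY

omit [FiniteDimensional ℝ E] in
lemma smul (hf : ContMDiff I 𝓘(ℝ, ℝ) ∞ f) (hX : IsSmoothVectorField I X) :
    IsSmoothVectorField I (f • X) :=
  ContMDiff.smul_section hf hX

omit [FiniteDimensional ℝ E] in
lemma const_smul (c : ℝ) (hX : IsSmoothVectorField I X) : IsSmoothVectorField I (c • X) :=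
  ContMDiff.const_smul_section hX

lemma mlieBracket (hX : IsSmoothVectorField I X) (hY : IsSmoothVectorField I Y) :
    IsSmoothVectorField I (mlieBracket I X Y) := by
  have := FiniteDimensional.complete ℝ E
  have : IsManifold I ((⊤ : ℕ∞) + 1) M := inferInstanceAs (IsManifold I ∞ M)
  have : IsManifold I (minSmoothness ℝ 2) M := by
    simpa using IsManifold.of_le (m := 2) (n := ∞) ENat.LEInfty.out
  exact ContDiff.mlieBracket_vectorField (m := ⊤) (n := ⊤) hX hY (by simp)

omit [FiniteDimensional ℝ E] in
lemma contMDiff_mvfderiv (hX : IsSmoothVectorField I X) (hf : ContMDiff I 𝓘(ℝ, ℝ) ∞ f) :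
    ContMDiff I 𝓘(ℝ, ℝ) ∞ (fun x ↦ mvfderiv I f x (X x)) := by
  have h := (hf.contMDiff_tangentMap (m := ∞) (by simp)).comp hX
  intro x
  have := (Bundle.contMDiffAt_totalSpace.1 (h x)).2
  simpa using! this

end IsSmoothVectorField

/-- A local section that is smooth near `x` agrees near `x` with a smooth vector field. -/
lemma exists_isSmoothVectorField_eventuallyEq [T2Space M] {x : M} {s : Set M}
    (hs : s ∈ nhds x) {X : Π x : M, TangentSpace I x}
    (hX : ContMDiffOn I (I.prod 𝓘(ℝ, E)) ∞ (fun x ↦ Bundle.TotalSpace.mk' E x (X x)) s) :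
    ∃ Y : Π x : M, TangentSpace I x, IsSmoothVectorField I Y ∧ ∀ᶠ y in nhds x, Y y = X y := by
  obtain ⟨u, hus, hu, hxu⟩ := mem_nhds_iff.1 hs
  obtain ⟨ψ, -, hψ⟩ := (SmoothBumpFunction.nhds_basis_tsupport (I := I) x).mem_iff.1
    (hu.mem_nhds hxu)
  refine ⟨(ψ : M → ℝ) • X, ContMDiffOn.smul_section_of_tsupport ψ.contMDiff.contMDiffOn hu hψ
    (hX.mono hus), ?_⟩
  filter_upwards [ψ.eventuallyEq_one] with y hy
  simp [hy]

/-- Allows identities between tensors at a point to be checked on global smooth fields. -/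
lemma exists_isSmoothVectorField_apply_eq [T2Space M] {x : M} (v : TangentSpace I x) :
    ∃ Y : Π x : M, TangentSpace I x, IsSmoothVectorField I Y ∧ Y x = v := by
  obtain ⟨s, hs, h⟩ := FiberBundle.exists_contMDiffOn_extend (k := ∞) I E v
  obtain ⟨Y, hY, hYv⟩ := exists_isSmoothVectorField_eventuallyEq hs h
  exact ⟨Y, hY, by simpa using hYv.self_of_nhds⟩

/-- The Lie bracket of vector fields acts on functions as the commutator of derivations. -/
lemma mvfderiv_mlieBracket [T2Space M] {X Y : Π x : M, TangentSpace I x}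
    (hX : IsSmoothVectorField I X) (hY : IsSmoothVectorField I Y) {f : M → ℝ}
    (hf : ContMDiff I 𝓘(ℝ, ℝ) ∞ f) (x : M) :
    mvfderiv I f x (mlieBracket I X Y x)
      = mvfderiv I (fun y ↦ mvfderiv I f y (Y y)) x (X x)
        - mvfderiv I (fun y ↦ mvfderiv I f y (X y)) x (Y x) := by
  have := FiniteDimensional.complete ℝ E
  -- Expand the Jacobi identity for X, Y, f • W by the Leibniz rule and subtract f times the one for
  -- X, Y, W: what survives is this multiple of W. It then suffices to choose W nonzero at x.
  have key (W : Π x : M, TangentSpace I x) (hW : IsSmoothVectorField I W) :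
      (mvfderiv I f x (mlieBracket I X Y x)
      - (mvfderiv I (fun y ↦ mvfderiv I f y (Y y)) x (X x)
        - mvfderiv I (fun y ↦ mvfderiv I f y (X y)) x (Y x))) • W x = 0 := by
    have : IsManifold I (minSmoothness ℝ 3) M := by
      simpa using IsManifold.of_le (m := 3) (n := ∞) ENat.LEInfty.out
    have hle : minSmoothness ℝ 2 ≤ ∞ := by
      rw [minSmoothness_of_isRCLikeNormedField]
      exact ENat.LEInfty.out
    have hf' := hf.mdifferentiable (by simp)
    have hXf := hX.contMDiff_mvfderiv hf
    have hYf := hY.contMDiff_mvfderiv hf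
    have jac := leibniz_identity_mlieBracket_apply ((hX x).of_le hle) ((hY x).of_le hle)
      (((hW.smul hf) x).of_le hle)
    have jac0 := leibniz_identity_mlieBracket_apply ((hX x).of_le hle) ((hY x).of_le hle)
      ((hW x).of_le hle)
    have e (V : Π x : M, TangentSpace I x) : mlieBracket I V (f • W)
        = (fun y ↦ mvfderiv I f y (V y)) • W + f • mlieBracket I V W :=
      funext fun y ↦ mlieBracket_smul_right (hf' y) (hW.mdifferentiableAt y)
    have e2 {V V' : Π x : M, TangentSpace I x} (hV : IsSmoothVectorField I V)
        (hV' : IsSmoothVectorField I V') : mlieBracket I V' (mlieBracket I V (f • W)) x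
        = mvfderiv I (fun y ↦ mvfderiv I f y (V y)) x (V' x) • W x
          + mvfderiv I f x (V x) • mlieBracket I V' W x
          + (mvfderiv I f x (V' x) • mlieBracket I V W x
          + f x • mlieBracket I V' (mlieBracket I V W) x) := by
      have hVf := hV.contMDiff_mvfderiv hf
      rw [e, mlieBracket_add_right ((hW.smul hVf).mdifferentiableAt x)
        (((hV.mlieBracket hW).smul hf).mdifferentiableAt x),
        mlieBracket_smul_right (hVf.mdifferentiable (by simp) x) (hW.mdifferentiableAt x),
        mlieBracket_smul_right (hf' x) ((hV.mlieBracket hW).mdifferentiableAt x)]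
    rw [e2 hY hX, e2 hX hY, congrFun (e _) x] at jac
    simp only [Pi.add_apply, Pi.smul_apply', jac0, smul_add] at jac
    rw [← neg_eq_zero, ← sub_eq_zero.2 jac]
    module
  by_cases hv : ∃ v : TangentSpace I x, v ≠ 0
  · obtain ⟨v, hv⟩ := hv
    obtain ⟨W, hW, rfl⟩ := exists_isSmoothVectorField_apply_eq v
    exact sub_eq_zero.1 ((smul_eq_zero.1 (key W hW)).resolve_right hv)
  · push Not at hv
    rw [hv (mlieBracket I X Y x), hv (X x), hv (Y x)]
    simp

/-! ### The Levi-Civita connection is metric and torsion free. -/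

namespace PseudoMetric

variable (g : PseudoMetric I M) {X Y Z : Π x : M, TangentSpace I x}

omit [FiniteDimensional ℝ E] in
lemma contMDiff_pairing (hX : IsSmoothVectorField I X) (hY : IsSmoothVectorField I Y) :
    ContMDiff I 𝓘(ℝ, ℝ) ∞ (g.pairing X Y) := by
  have := g.contMDiff.clm_bundle_apply₂ (F₁ := E) (F₂ := E) (F₃ := ℝ)
    (E₃ := Bundle.Trivial M ℝ) hX hY
  intro x
  exact (Bundle.contMDiffAt_totalSpace.1 (this x)).2

lemma contMDiff_koszul (hX : IsSmoothVectorField I X) (hY : IsSmoothVectorField I Y)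
    (hZ : IsSmoothVectorField I Z) : ContMDiff I 𝓘(ℝ, ℝ) ∞ (g.koszul X Y Z) := by
  have h1 := hX.contMDiff_mvfderiv (g.contMDiff_pairing hY hZ)
  have h2 := hY.contMDiff_mvfderiv (g.contMDiff_pairing hX hZ)
  have h3 := hZ.contMDiff_mvfderiv (g.contMDiff_pairing hX hY)
  have h4 := g.contMDiff_pairing (hX.mlieBracket hY) hZ
  have h5 := g.contMDiff_pairing (hX.mlieBracket hZ) hY
  have h6 := g.contMDiff_pairing (hY.mlieBracket hZ) hX
  exact ((((h1.add h2).sub h3).add h4).sub h5).sub h6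

lemma two_mul_nabla (hX : IsSmoothVectorField I X) (hY : IsSmoothVectorField I Y)
    (hZ : IsSmoothVectorField I Z) (x : M) :
    2 * g.val x (g.nabla X Y x) (Z x) = g.koszul X Y Z x :=
  g.two_mul_leviCivitaAux (hX.mdifferentiableAt x) (hY.mdifferentiableAt x)
    (hZ.mdifferentiableAt x)

/-- The Levi-Civita connection is compatible with the metric. -/
lemma mvfderiv_pairing (hX : IsSmoothVectorField I X) (hY : IsSmoothVectorField I Y)
    (hZ : IsSmoothVectorField I Z) (x : M) :
    mvfderiv I (g.pairing Y Z) x (X x)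
      = g.val x (g.nabla X Y x) (Z x) + g.val x (Y x) (g.nabla X Z x) := by
  have h1 := g.two_mul_nabla hX hY hZ x
  have h2 := g.two_mul_nabla hX hZ hY x
  rw [g.symm x (Y x)]
  simp only [koszul, g.pairing_comm Z Y, mlieBracket_swap_apply (V := Z) (W := Y)] at h1 h2
  simp only [map_neg, neg_apply] at h2
  linarith

lemma eq_of_forall_val [T2Space M] {x : M} {v w : TangentSpace I x}
    (h : ∀ Z, IsSmoothVectorField I Z → g.val x v (Z x) = g.val x w (Z x)) : v = w := by
  refine sub_eq_zero.1 (g.nondegenerate x _ fun u ↦ ?_)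
  obtain ⟨Z, hZ, rfl⟩ := exists_isSmoothVectorField_apply_eq u
  simp [h Z hZ]

/-- The Levi-Civita connection is torsion free. -/
lemma nabla_sub_nabla [T2Space M] (hX : IsSmoothVectorField I X) (hY : IsSmoothVectorField I Y)
    (x : M) : g.nabla X Y x - g.nabla Y X x = mlieBracket I X Y x := by
  refine g.eq_of_forall_val fun Z hZ ↦ ?_
  have h1 := g.two_mul_nabla hX hY hZ x
  have h2 := g.two_mul_nabla hY hX hZ x
  simp only [koszul, g.pairing_comm Y X, mlieBracket_swap_apply (V := Y) (W := X)] at h1 h2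
  simp only [map_neg, neg_apply, map_sub, sub_apply] at h1 h2 ⊢
  linarith

end PseudoMetric

/-! ### Smoothness of ∇_X Y and skewness of the curvature. -/

omit [FiniteDimensional ℝ E] [IsManifold I ∞ M] in
lemma contMDiffAt_det {ι : Type*} [Fintype ι] [DecidableEq ι] {G : M → Matrix ι ι ℝ} {x : M}
    (hG : ∀ i j, ContMDiffAt I 𝓘(ℝ, ℝ) ∞ (fun y ↦ G y i j) x) :
    ContMDiffAt I 𝓘(ℝ, ℝ) ∞ (fun y ↦ (G y).det) x := by
  simp only [Matrix.det_apply']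
  exact contMDiffAt_finsetSum fun σ _ ↦ contMDiffAt_const.mul <|
    contMDiffAt_finsetProd fun i _ ↦ hG _ _

omit [FiniteDimensional ℝ E] [IsManifold I ∞ M] in
/-- The solution of a linear system with smooth coefficients is smooth wherever the system is
nondegenerate. -/
lemma contMDiffAt_of_mulVec_eq {ι : Type*} [Fintype ι] [DecidableEq ι] {G : M → Matrix ι ι ℝ}
    {c k : M → ι → ℝ} {x : M} (hG : ∀ i j, ContMDiffAt I 𝓘(ℝ, ℝ) ∞ (fun y ↦ G y i j) x)
    (hk : ∀ i, ContMDiffAt I 𝓘(ℝ, ℝ) ∞ (fun y ↦ k y i) x) (hdet : (G x).det ≠ 0)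
    (h : ∀ᶠ y in nhds x, (G y).mulVec (c y) = k y) (j : ι) :
    ContMDiffAt I 𝓘(ℝ, ℝ) ∞ (fun y ↦ c y j) x := by
  have hd := contMDiffAt_det hG
  -- Cramer's rule: near x, c is the Cramer vector divided by det G.
  have hcr : ContMDiffAt I 𝓘(ℝ, ℝ) ∞ (fun y ↦ (G y).cramer (k y) j) x := by
    simp only [Matrix.cramer_apply]
    refine contMDiffAt_det fun i i' ↦ ?_
    by_cases hi : i' = j
    · subst hi
      simpa using hk i
    · simpa [Matrix.updateCol_apply, hi] using hG i i'
  refine ((hd.inv₀ hdet).mul hcr).congr_of_eventuallyEq ?_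
  filter_upwards [h, hd.continuousAt.eventually_ne hdet] with y hy hne
  simp [← hy, Matrix.cramer_eq_adjugate_mulVec, Matrix.mulVec_mulVec, Matrix.adjugate_mul,
    Matrix.smul_mulVec, hne]

namespace PseudoMetric

variable [T2Space M] (g : PseudoMetric I M) {X Y : Π x : M, TangentSpace I x}

/-- A vector field is smooth if its pairings with smooth fields are smooth. -/
lemma isSmoothVectorField_of_pairing (V : Π x : M, TangentSpace I x)
    (hV : ∀ Z, IsSmoothVectorField I Z → ContMDiff I 𝓘(ℝ, ℝ) ∞ (g.pairing V Z)) :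
    IsSmoothVectorField I V := by
  classical
  intro x
  set e := trivializationAt E (TangentSpace I : M → Type _) x
  set b := Module.finBasis ℝ E
  have hx : x ∈ e.baseSet := FiberBundle.mem_baseSet_trivializationAt' x
  have hbase := e.open_baseSet.mem_nhds hx
  choose s hs hse using fun i ↦ exists_isSmoothVectorField_eventuallyEq hbase
    (e.contMDiffOn_localFrame_baseSet (I := I) ∞ b i)
  rw [contMDiffAt_iff_localFrameCoeff b hx]
  have hval (y : M) (hy : y ∈ e.baseSet) (w : TangentSpace I y) (c : _ → ℝ) :
      g.val y (∑ j, c j • e.localFrame b j y) w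
        = ∑ j, g.val y (e.localFrame b j y) w * c j := by
    simp [mul_comm]
  refine contMDiffAt_of_mulVec_eq (G := fun y ↦ Matrix.of fun i j ↦ g.pairing (s j) (s i) y)
    (c := fun y j ↦ e.localFrameCoeff I b j y (V y)) (k := fun y i ↦ g.pairing V (s i) y)
    (fun i j ↦ g.contMDiff_pairing (hs j) (hs i) x) (fun i ↦ hV _ (hs i) x) ?_ ?_
  -- A kernel vector of the Gram matrix is a combination of the frame orthogonal to the whole frame,
  -- which nondegeneracy forbids.
  · intro h0
    obtain ⟨c, hc, hGc⟩ := Matrix.exists_mulVec_eq_zero_iff.2 h0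
    have hw : ∑ j, c j • e.localFrame b j x = 0 := by
      refine g.nondegenerate x _ fun w ↦ ?_
      have hbas : g.val x (∑ j, c j • e.localFrame b j x)
          = (0 : TangentSpace I x →L[ℝ] ℝ) := by
        apply ContinuousLinearMap.coe_injective
        refine (e.basisAt b hx).ext fun i ↦ ?_
        have := congrFun hGc i
        simp only [Matrix.mulVec, dotProduct, Matrix.of_apply, pairing, Pi.zero_apply,
          (hse _).self_of_nhds] at this
        rw [← hval x hx, e.localFrame_apply_of_mem_baseSet b hx (i := i)] at this
        simpa using! this
      rw [hbas]
      rfl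
    simp only [e.localFrame_apply_of_mem_baseSet b hx] at hw
    exact hc (funext (Fintype.linearIndependent_iff.1 (e.basisAt b hx).linearIndependent c hw))
  · filter_upwards [hbase, Filter.eventually_all.2 hse] with y hy hsy
    ext i
    simp only [Matrix.mulVec, dotProduct, Matrix.of_apply, pairing, hsy]
    rw [← hval y hy, ← e.eq_sum_localFrameCoeff_smul hy]

/-- Makes the iterated derivatives in the curvature accessible to the Leibniz and metric rules. -/
lemma isSmoothVectorField_nabla (hX : IsSmoothVectorField I X) (hY : IsSmoothVectorField I Y) :
    IsSmoothVectorField I (g.nabla X Y) := by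
  refine g.isSmoothVectorField_of_pairing _ fun Z hZ ↦ ?_
  have : g.pairing (g.nabla X Y) Z = fun x ↦ (1 / 2) * g.koszul X Y Z x := by
    ext x
    rw [← g.two_mul_nabla hX hY hZ, pairing]
    ring
  rw [this]
  exact contMDiff_const.mul (g.contMDiff_koszul hX hY hZ)

omit [T2Space M] in
lemma nabla_add (X : Π x : M, TangentSpace I x) {Y Y' : Π x : M, TangentSpace I x}
    (hY : IsSmoothVectorField I Y) (hY' : IsSmoothVectorField I Y') (x : M) :
    g.nabla X (Y + Y') x = g.nabla X Y x + g.nabla X Y' x := by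
  simp [nabla, g.leviCivita.isCovariantDerivativeOnUniv.add (hY.mdifferentiableAt x)
    (hY'.mdifferentiableAt x) trivial]

omit [T2Space M] in
lemma nabla_smul (X : Π x : M, TangentSpace I x) {f : M → ℝ} {Y : Π x : M, TangentSpace I x}
    (hf : ContMDiff I 𝓘(ℝ, ℝ) ∞ f) (hY : IsSmoothVectorField I Y) (x : M) :
    g.nabla X (f • Y) x = f x • g.nabla X Y x + mvfderiv I f x (X x) • Y x := by
  simp [nabla, g.leviCivita.isCovariantDerivativeOnUniv.leibniz (hY.mdifferentiableAt x)
    (hf.mdifferentiable (by simp) x) trivial]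

omit [T2Space M] in
lemma nabla_const_smul (X : Π x : M, TangentSpace I x) (c : ℝ) {Y : Π x : M, TangentSpace I x}
    (hY : IsSmoothVectorField I Y) (x : M) :
    g.nabla X (c • Y) x = c • g.nabla X Y x := by
  simp [nabla, g.leviCivita.isCovariantDerivativeOnUniv.smul_const c (hY.mdifferentiableAt x)]

omit [T2Space M] in
lemma nabla_sub (X : Π x : M, TangentSpace I x) {Y Y' : Π x : M, TangentSpace I x}
    (hY : IsSmoothVectorField I Y) (hY' : IsSmoothVectorField I Y') (x : M) :
    g.nabla X (Y - Y') x = g.nabla X Y x - g.nabla X Y' x := by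
  have : Y - Y' = Y + (-1 : ℝ) • Y' := by simp [sub_eq_add_neg]
  rw [this, g.nabla_add X hY (hY'.const_smul _), g.nabla_const_smul X _ hY']
  module

/-- The curvature operators of the Levi-Civita connection are skew-adjoint. -/
lemma val_curvature_add {Z W : Π x : M, TangentSpace I x} (hX : IsSmoothVectorField I X)
    (hY : IsSmoothVectorField I Y) (hZ : IsSmoothVectorField I Z) (hW : IsSmoothVectorField I W)
    (x : M) : g.val x (g.curvature X Y Z x) (W x) + g.val x (g.curvature X Y W x) (Z x) = 0 := by
  -- The mixed terms are symmetric in X and Y, so they drop out of the commutator XY - YX acting on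
  -- g(Z, W).
  have key {X Y : Π x : M, TangentSpace I x} (hX : IsSmoothVectorField I X)
      (hY : IsSmoothVectorField I Y) :
      mvfderiv I (fun y ↦ mvfderiv I (g.pairing Z W) y (Y y)) x (X x)
      = g.val x (g.nabla X (g.nabla Y Z) x) (W x) + g.val x (g.nabla Y Z x) (g.nabla X W x)
        + (g.val x (g.nabla X Z x) (g.nabla Y W x)
          + g.val x (Z x) (g.nabla X (g.nabla Y W) x)) := by
    have hYZ := g.isSmoothVectorField_nabla hY hZ
    have hYW := g.isSmoothVectorField_nabla hY hW
    have : (fun y ↦ mvfderiv I (g.pairing Z W) y (Y y))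
        = g.pairing (g.nabla Y Z) W + g.pairing Z (g.nabla Y W) :=
      funext fun y ↦ g.mvfderiv_pairing hY hZ hW y
    rw [this, mvfderiv_add ((g.contMDiff_pairing hYZ hW).mdifferentiable (by simp) x)
      ((g.contMDiff_pairing hZ hYW).mdifferentiable (by simp) x), add_apply,
      g.mvfderiv_pairing hX hYZ hW, g.mvfderiv_pairing hX hZ hYW]
  have h := mvfderiv_mlieBracket hX hY (g.contMDiff_pairing hZ hW) x
  rw [key hX hY, key hY hX, g.mvfderiv_pairing (hX.mlieBracket hY) hZ hW] at h
  simp only [curvature, map_sub, sub_apply]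
  rw [g.symm x (Z x), g.symm x (Z x), g.symm x (Z x)] at h
  linarith

end PseudoMetric

namespace AlmostParaContactMetric

variable {ε₀ ε₁ : ℝ} (S : AlmostParaContactMetric I M ε₀ ε₁) {X Y Z : Π x : M, TangentSpace I x}

omit [FiniteDimensional ℝ E] in
lemma isSmoothVectorField_phi (hX : IsSmoothVectorField I X) : IsSmoothVectorField I (S.phi X) :=
  S.φ_smooth.clm_bundle_apply (F₁ := E) (F₂ := E) hX

omit [FiniteDimensional ℝ E] in
lemma contMDiff_η (hX : IsSmoothVectorField I X) :
    ContMDiff I 𝓘(ℝ, ℝ) ∞ (fun x ↦ S.η x (X x)) := by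
  have := S.η_smooth.clm_bundle_apply (F₁ := E) (F₂ := ℝ) (E₂ := Bundle.Trivial M ℝ) hX
  exact fun x ↦ (Bundle.contMDiffAt_totalSpace.1 (this x)).2

/-! ### Pointwise algebra of (φ, ξ, η, g). -/

section Pointwise

variable (hε₁ : ε₁ * ε₁ = 1) {x : M} (v w : TangentSpace I x)
include hε₁

omit [FiniteDimensional ℝ E] in
-- Since φ²ξ = 0, also φ³ξ = 0, which gives φξ = cξ with c = η(φξ); then φ²ξ = c²ξ forces c = 0.
lemma φ_ξ : S.φ x (S.ξ x) = 0 := by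
  have h0 : S.φ x (S.φ x (S.ξ x)) = 0 := by simp [S.φ_sq, S.η_ξ]
  have hε : ε₁ ≠ 0 := left_ne_zero_of_mul_eq_one hε₁
  have h1 := S.φ_sq x (S.φ x (S.ξ x))
  rw [h0, map_zero, eq_comm, smul_eq_zero_iff_right hε, sub_eq_zero] at h1
  have h2 := h0
  rw [h1, map_smul, h1, smul_smul] at h2
  have h3 := congrArg (S.η x) h2
  simp only [map_smul, S.η_ξ, map_zero, smul_eq_mul, mul_one, mul_self_eq_zero] at h3
  rw [h1, h3, zero_smul]

omit [FiniteDimensional ℝ E] in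
-- Compare φ(φ²v) with φ²(φv): they differ by a multiple of η(φv)ξ.
lemma η_φ : S.η x (S.φ x v) = 0 := by
  have hε : ε₁ ≠ 0 := left_ne_zero_of_mul_eq_one hε₁
  have h1 := S.φ_sq x (S.φ x v)
  rw [S.φ_sq x v, map_smul, map_sub, map_smul, S.φ_ξ hε₁, smul_zero, sub_zero, smul_right_inj hε,
    eq_comm, sub_eq_self] at h1
  have h2 := congrArg (S.η x) h1
  simpa [S.η_ξ] using h2

omit [FiniteDimensional ℝ E] in
lemma φ_cube : S.φ x (S.φ x (S.φ x v)) = ε₁ • S.φ x v := by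
  rw [S.φ_sq x (S.φ x v), S.η_φ hε₁]
  simp

omit [FiniteDimensional ℝ E] in
lemma val_ξ : S.g.val x (S.ξ x) v = ε₀ * S.η x v := by
  have hε : ε₁ ≠ 0 := left_ne_zero_of_mul_eq_one hε₁
  have h := S.compat x (S.ξ x) v
  rw [S.φ_ξ hε₁, map_zero, S.η_ξ, one_mul, zero_apply, eq_comm] at h
  exact sub_eq_zero.1 ((mul_eq_zero.1 h).resolve_left (neg_ne_zero.2 hε))

omit [FiniteDimensional ℝ E] in
-- Put φw for w in the compatibility condition; the ξ-part of φ²w is orthogonal to φv.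
lemma val_φ : S.g.val x (S.φ x v) w = -S.g.val x v (S.φ x w) := by
  have h := S.compat x v (S.φ x w)
  rw [S.φ_sq x w, S.η_φ hε₁, map_smul, map_sub, map_smul, S.g.symm x _ (S.ξ x),
    S.val_ξ hε₁, S.η_φ hε₁] at h
  simp only [smul_eq_mul] at h
  linear_combination ε₁ * h + (S.g.val x v (S.φ x w) + S.g.val x (S.φ x v) w) * (-hε₁)

end Pointwise

/-- The covariant derivative `v ↦ ∇_v ξ` of the characteristic vector field. -/
def nablaξ (x : M) : TangentSpace I x →L[ℝ] TangentSpace I x := S.g.leviCivita S.ξ x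

lemma nabla_ξ_apply (X : Π x : M, TangentSpace I x) (x : M) :
    S.g.nabla X S.ξ x = S.nablaξ x (X x) := rfl

/-- The covariant derivative `(∇_X φ)Y`. -/
def nablaPhi (X Y : Π x : M, TangentSpace I x) : Π x : M, TangentSpace I x :=
  S.g.nabla X (S.phi Y) - S.phi (S.g.nabla X Y)

lemma nabla_phi_apply (X Y : Π x : M, TangentSpace I x) (x : M) :
    S.g.nabla X (S.phi Y) x = S.nablaPhi X Y x + S.φ x (S.g.nabla X Y x) := by
  simp [nablaPhi, phi]

variable [T2Space M]

lemma isSmoothVectorField_nablaPhi (hX : IsSmoothVectorField I X) (hY : IsSmoothVectorField I Y) :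
    IsSmoothVectorField I (S.nablaPhi X Y) :=
  (S.g.isSmoothVectorField_nabla hX (S.isSmoothVectorField_phi hY)).sub
    (S.isSmoothVectorField_phi (S.g.isSmoothVectorField_nabla hX hY))

/-! ### Derivatives of the structure identities. -/

section Eta

variable (hε₀ : ε₀ * ε₀ = 1) (hε₁ : ε₁ * ε₁ = 1)
include hε₀ hε₁

omit [T2Space M] in
lemma mvfderiv_η (hX : IsSmoothVectorField I X) (hY : IsSmoothVectorField I Y) (x : M) :
    mvfderiv I (fun y ↦ S.η y (Y y)) x (X x)
      = ε₀ * S.g.val x (S.nablaξ x (X x)) (Y x) + S.η x (S.g.nabla X Y x) := by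
  have : S.g.pairing S.ξ Y = (fun _ ↦ ε₀) * fun y ↦ S.η y (Y y) :=
    funext fun y ↦ S.val_ξ hε₁ (Y y)
  have h := S.g.mvfderiv_pairing hX S.ξ_smooth hY x
  rw [this, mvfderiv_mul mdifferentiableAt_const
    ((S.contMDiff_η hY).mdifferentiable (by simp) x), S.val_ξ hε₁, nabla_ξ_apply] at h
  simp only [mvfderiv_const, smul_zero, add_zero, smul_apply, smul_eq_mul] at h
  linear_combination ε₀ * h + (S.η x (S.g.nabla X Y x)
    - mvfderiv I (fun y ↦ S.η y (Y y)) x (X x)) * hε₀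

/-- g(ξ, ξ) = ε₀ is constant. -/
lemma η_nablaξ {x : M} (v : TangentSpace I x) : S.η x (S.nablaξ x v) = 0 := by
  obtain ⟨X, hX, rfl⟩ := exists_isSmoothVectorField_apply_eq v
  have h := S.mvfderiv_η hε₀ hε₁ hX S.ξ_smooth x
  simp only [S.η_ξ, mvfderiv_const, nabla_ξ_apply] at h
  rw [S.g.symm, S.val_ξ hε₁] at h
  simp only [zero_apply] at h
  linear_combination (-1 / 2) * h - (1 / 2) * S.η x (S.nablaξ x (X x)) * hε₀

omit [T2Space M] in
-- The covariant derivative of φ² = ε₁(1 - η ⊗ ξ).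
lemma nablaPhi_phi (hX : IsSmoothVectorField I X) (hY : IsSmoothVectorField I Y) (x : M) :
    S.nablaPhi X (S.phi Y) x = -S.φ x (S.nablaPhi X Y x)
      - ε₁ • (S.η x (Y x) • S.nablaξ x (X x)
        + (ε₀ * S.g.val x (S.nablaξ x (X x)) (Y x)) • S.ξ x) := by
  have h : S.phi (S.phi Y) = ε₁ • (Y - (fun y ↦ S.η y (Y y)) • S.ξ) :=
    funext fun y ↦ S.φ_sq y (Y y)
  have h1 := S.nabla_phi_apply X (S.phi Y) x
  have hη := S.contMDiff_η hY
  rw [h, S.g.nabla_const_smul X _ (hY.sub (S.ξ_smooth.smul hη)),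
    S.g.nabla_sub X hY (S.ξ_smooth.smul hη), S.g.nabla_smul X hη S.ξ_smooth,
    S.mvfderiv_η hε₀ hε₁ hX hY, S.nabla_phi_apply, map_add, S.φ_sq, nabla_ξ_apply] at h1
  rw [eq_sub_of_add_eq h1.symm]
  module

omit [T2Space M] hε₀ in
lemma nablaPhi_ξ (X : Π x : M, TangentSpace I x) (x : M) :
    S.nablaPhi X S.ξ x = -S.φ x (S.nablaξ x (X x)) := by
  have h : S.phi S.ξ = 0 := funext fun y ↦ S.φ_ξ hε₁
  have h1 := S.nabla_phi_apply X S.ξ x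
  rw [h, PseudoMetric.nabla, S.g.leviCivita.zero, nabla_ξ_apply] at h1
  simpa [eq_neg_iff_add_eq_zero] using h1.symm

omit [T2Space M] hε₀ hε₁ in
lemma nablaFundamentalForm_eq (hX : IsSmoothVectorField I X) (hY : IsSmoothVectorField I Y)
    (hZ : IsSmoothVectorField I Z) (x : M) :
    S.nablaFundamentalForm X Y Z x = S.g.val x (Y x) (S.nablaPhi X Z x) := by
  have h := S.g.mvfderiv_pairing hX hY (S.isSmoothVectorField_phi hZ) x
  rw [S.nabla_phi_apply, map_add] at h
  simp only [nablaFundamentalForm, fundamentalForm]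
  change mvfderiv I (S.g.pairing Y (S.phi Z)) x (X x) - _ - _ = _
  rw [h]
  simp [phi]

omit [T2Space M] hε₀ in
lemma nablaFundamentalForm_swap (X Y Z : Π x : M, TangentSpace I x) (x : M) :
    S.nablaFundamentalForm X Y Z x = -S.nablaFundamentalForm X Z Y x := by
  have h (Y Z : Π x : M, TangentSpace I x) :
      S.fundamentalForm Y Z = -S.fundamentalForm Z Y := by
    ext y
    simp only [fundamentalForm, Pi.neg_apply]
    rw [S.g.symm, S.val_φ hε₁]
  simp only [nablaFundamentalForm]
  rw [h Y Z, h (S.g.nabla X Y) Z, h Y, mvfderiv_neg]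
  simp only [Pi.neg_apply, neg_apply]
  ring

omit [T2Space M] in
lemma nablaFundamentalForm_phi_left (hX : IsSmoothVectorField I X) (hY : IsSmoothVectorField I Y)
    (hZ : IsSmoothVectorField I Z) (x : M) :
    S.nablaFundamentalForm X (S.phi Y) Z x = S.nablaFundamentalForm X Y (S.phi Z) x
      + ε₁ * (S.η x (Y x) * S.g.val x (S.nablaξ x (X x)) (Z x)
        + S.η x (Z x) * S.g.val x (S.nablaξ x (X x)) (Y x)) := by
  rw [S.nablaFundamentalForm_eq hX (S.isSmoothVectorField_phi hY) hZ,
    S.nablaFundamentalForm_eq hX hY (S.isSmoothVectorField_phi hZ),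
    S.nablaPhi_phi hε₀ hε₁ hX hZ, phi, S.val_φ hε₁]
  simp only [map_sub, map_neg, map_smul, map_add, smul_eq_mul]
  rw [S.g.symm x (Y x) (S.ξ x), S.val_ξ hε₁, S.g.symm x (Y x) (S.nablaξ x (X x))]
  linear_combination ε₁ * S.η x (Y x) * S.g.val x (S.nablaξ x (X x)) (Z x) * hε₀

omit [T2Space M] in
lemma nablaFundamentalForm_phi_phi (hX : IsSmoothVectorField I X) (hY : IsSmoothVectorField I Y)
    (hZ : IsSmoothVectorField I Z) (x : M) :
    S.nablaFundamentalForm X (S.phi Y) (S.phi Z) x = ε₁ * S.nablaFundamentalForm X Y Z x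
      + ε₁ * (S.η x (Y x) * S.g.val x (S.nablaξ x (X x)) (S.φ x (Z x))
        - S.η x (Z x) * S.g.val x (S.nablaξ x (X x)) (S.φ x (Y x))) := by
  -- Skewness of ∇_X Φ moves ξ into the slot where (∇_X φ)ξ = -φAX applies.
  have hη : S.η x (S.nablaPhi X Z x)
      = -ε₀ * S.g.val x (S.nablaξ x (X x)) (S.φ x (Z x)) := by
    have h := S.nablaFundamentalForm_swap hε₁ X S.ξ Z x
    rw [S.nablaFundamentalForm_eq hX S.ξ_smooth hZ,
      S.nablaFundamentalForm_eq hX hZ S.ξ_smooth, S.nablaPhi_ξ hε₁, S.val_ξ hε₁, map_neg,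
      S.g.symm x (Z x), S.val_φ hε₁] at h
    linear_combination ε₀ * h - S.η x (S.nablaPhi X Z x) * hε₀
  rw [S.nablaFundamentalForm_eq hX (S.isSmoothVectorField_phi hY)
    (S.isSmoothVectorField_phi hZ), S.nablaFundamentalForm_eq hX hY hZ,
    S.nablaPhi_phi hε₀ hε₁ hX hZ, phi]
  simp only [map_sub, map_neg, map_smul, map_add, smul_eq_mul]
  rw [S.compat, hη, S.g.symm x (S.φ x (Y x)) (S.ξ x), S.val_ξ hε₁, S.η_φ hε₁,
    S.g.symm x (S.φ x (Y x)) (S.nablaξ x (X x))]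
  linear_combination ε₁ * S.η x (Y x) * S.g.val x (S.nablaξ x (X x)) (S.φ x (Z x)) * hε₀

end Eta

end AlmostParaContactMetric

/-! ### Consequences of Φ = dη: closedness of Φ, and the relations between A, φ and h. -/

namespace AlmostParaContactMetric

variable {ε₀ ε₁ : ℝ} {S : AlmostParaContactMetric I M ε₀ ε₁} [T2Space M]

namespace IsParaContactMetric

variable {X Y Z : Π x : M, TangentSpace I x} (hS : S.IsParaContactMetric)
  (hε₀ : ε₀ * ε₀ = 1) (hε₁ : ε₁ * ε₁ = 1)
include hS

omit [FiniteDimensional ℝ E] [T2Space M] in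
lemma two_mul_fundamentalForm (hX : IsSmoothVectorField I X) (hY : IsSmoothVectorField I Y)
    (x : M) : 2 * S.fundamentalForm X Y x
      = mvfderiv I (fun y ↦ S.η y (Y y)) x (X x) - mvfderiv I (fun y ↦ S.η y (X y)) x (Y x)
        - S.η x (mlieBracket I X Y x) := by
  rw [hS x X Y (hX.mdifferentiableAt x) (hY.mdifferentiableAt x), extDerivOneForm]
  ring

omit [T2Space M] in
lemma two_mul_mvfderiv_fundamentalForm (X : Π x : M, TangentSpace I x)
    (hY : IsSmoothVectorField I Y) (hZ : IsSmoothVectorField I Z) (x : M) :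
    2 * mvfderiv I (S.fundamentalForm Y Z) x (X x)
      = mvfderiv I (fun y ↦ mvfderiv I (fun y ↦ S.η y (Z y)) y (Y y)) x (X x)
        - mvfderiv I (fun y ↦ mvfderiv I (fun y ↦ S.η y (Y y)) y (Z y)) x (X x)
        - mvfderiv I (fun y ↦ S.η y (mlieBracket I Y Z y)) x (X x) := by
  have h : (fun _ ↦ (2 : ℝ)) * S.fundamentalForm Y Z
      = (fun y ↦ mvfderiv I (fun y ↦ S.η y (Z y)) y (Y y))
        - (fun y ↦ mvfderiv I (fun y ↦ S.η y (Y y)) y (Z y))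
        - fun y ↦ S.η y (mlieBracket I Y Z y) :=
    funext fun y ↦ hS.two_mul_fundamentalForm hY hZ y
  have h1 := (hY.contMDiff_mvfderiv (S.contMDiff_η hZ)).mdifferentiable (by simp) x
  have h2 := (hZ.contMDiff_mvfderiv (S.contMDiff_η hY)).mdifferentiable (by simp) x
  have h3 := (S.contMDiff_η (hY.mlieBracket hZ)).mdifferentiable (by simp) x
  have h4 : MDifferentiableAt I 𝓘(ℝ, ℝ) (S.fundamentalForm Y Z) x :=
    (S.g.contMDiff_pairing hY (S.isSmoothVectorField_phi hZ)).mdifferentiable (by simp) x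
  have h5 := congrArg (fun f ↦ mvfderiv I f x (X x)) h
  beta_reduce at h5
  rw [mvfderiv_mul mdifferentiableAt_const h4, mvfderiv_sub (h1.sub h2) h3,
    mvfderiv_sub h1 h2] at h5
  simpa [mvfderiv_const] using h5

include hε₁ in
/-- The fundamental form of a paracontact metric structure is closed. -/
lemma nablaFundamentalForm_cyclic (hX : IsSmoothVectorField I X) (hY : IsSmoothVectorField I Y)
    (hZ : IsSmoothVectorField I Z) (x : M) :
    S.nablaFundamentalForm X Y Z x + S.nablaFundamentalForm Y Z X x
      + S.nablaFundamentalForm Z X Y x = 0 := by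
  have := FiniteDimensional.complete ℝ E
  have : IsManifold I (minSmoothness ℝ 3) M := by
    simpa using IsManifold.of_le (m := 3) (n := ∞) ENat.LEInfty.out
  have hle : minSmoothness ℝ 2 ≤ ∞ := by
    rw [minSmoothness_of_isRCLikeNormedField]
    exact ENat.LEInfty.out
  have jac := congrArg (S.η x) (leibniz_identity_mlieBracket_apply ((hX x).of_le hle)
    ((hY x).of_le hle) ((hZ x).of_le hle))
  rw [mlieBracket_swap_apply (V := X), mlieBracket_swap_apply (V := Y) (W := mlieBracket I X Z),
    mlieBracket_swap (V := X) (W := Z), ← neg_one_smul ℝ (mlieBracket I Z X),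
    mlieBracket_const_smul_left ((hZ.mlieBracket hX).mdifferentiableAt x)] at jac
  -- Torsion-freeness turns the cyclic sum of ∇Φ into dΦ up to a constant; it vanishes as d²η, with
  -- second derivatives cancelling against brackets and the double brackets against each other by
  -- Jacobi.
  have skew {X Y Z : Π x : M, TangentSpace I x} (hX : IsSmoothVectorField I X)
      (hY : IsSmoothVectorField I Y) : S.fundamentalForm (S.g.nabla X Y) Z x
        + S.fundamentalForm Z (S.g.nabla Y X) x
        = S.fundamentalForm (mlieBracket I X Y) Z x := by
    simp only [fundamentalForm]
    rw [← S.g.nabla_sub_nabla hX hY, S.g.symm x (Z x), S.val_φ hε₁, map_sub, sub_apply]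
    ring
  have a1 := hS.two_mul_mvfderiv_fundamentalForm X hY hZ x
  have a2 := hS.two_mul_mvfderiv_fundamentalForm Y hZ hX x
  have a3 := hS.two_mul_mvfderiv_fundamentalForm Z hX hY x
  have b1 := hS.two_mul_fundamentalForm (hX.mlieBracket hY) hZ x
  have b2 := hS.two_mul_fundamentalForm (hY.mlieBracket hZ) hX x
  have b3 := hS.two_mul_fundamentalForm (hZ.mlieBracket hX) hY x
  rw [mvfderiv_mlieBracket hX hY (S.contMDiff_η hZ)] at b1
  rw [mvfderiv_mlieBracket hY hZ (S.contMDiff_η hX)] at b2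
  rw [mvfderiv_mlieBracket hZ hX (S.contMDiff_η hY)] at b3
  have c1 := skew (Z := Z) hX hY
  have c2 := skew (Z := X) hY hZ
  have c3 := skew (Z := Y) hZ hX
  simp only [map_add, map_neg, map_smul, smul_eq_mul] at jac
  simp only [nablaFundamentalForm]
  linarith

include hε₀ hε₁

/-- This is 2Φ = 2dη with dη written through the torsion-free connection. -/
lemma val_nablaξ_sub {x : M} (v w : TangentSpace I x) :
    S.g.val x (S.nablaξ x v) w = S.g.val x (S.nablaξ x w) v + 2 * ε₀ * S.g.val x v (S.φ x w) := by
  obtain ⟨X, hX, rfl⟩ := exists_isSmoothVectorField_apply_eq v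
  obtain ⟨Y, hY, rfl⟩ := exists_isSmoothVectorField_apply_eq w
  have h := hS.two_mul_fundamentalForm hX hY x
  rw [S.mvfderiv_η hε₀ hε₁ hX hY, S.mvfderiv_η hε₀ hε₁ hY hX, ← S.g.nabla_sub_nabla hX hY,
    map_sub, fundamentalForm] at h
  linear_combination -ε₀ * h + (S.g.val x (S.nablaξ x (Y x)) (X x)
    - S.g.val x (S.nablaξ x (X x)) (Y x)) * hε₀

lemma nablaξ_ξ (x : M) : S.nablaξ x (S.ξ x) = 0 := by
  refine S.g.nondegenerate x _ fun w ↦ ?_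
  rw [hS.val_nablaξ_sub hε₀ hε₁, S.g.symm, S.val_ξ hε₁, S.val_ξ hε₁, S.η_nablaξ hε₀ hε₁,
    S.η_φ hε₁]
  ring

lemma nablaξ_φ_φ {x : M} (v : TangentSpace I x) :
    S.nablaξ x (S.φ x (S.φ x v)) = ε₁ • S.nablaξ x v := by
  rw [S.φ_sq, map_smul, map_sub, map_smul, hS.nablaξ_ξ hε₀ hε₁]
  simp

omit hS in
lemma φ_φ_nablaξ {x : M} (v : TangentSpace I x) :
    S.φ x (S.φ x (S.nablaξ x v)) = ε₁ • S.nablaξ x v := by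
  rw [S.φ_sq, S.η_nablaξ hε₀ hε₁]
  simp

/-- Closedness with one argument ξ: the other two terms are known from (∇φ)ξ = -φA. -/
lemma nablaFundamentalForm_ξ_left (hY : IsSmoothVectorField I Y) (hZ : IsSmoothVectorField I Z)
    (x : M) : S.nablaFundamentalForm S.ξ Y Z x
      = S.g.val x (S.φ x (S.nablaξ x (Y x)) + S.nablaξ x (S.φ x (Y x))
        + (2 * ε₀) • S.φ x (S.φ x (Y x))) (Z x) := by
  have h := hS.nablaFundamentalForm_cyclic hε₁ S.ξ_smooth hY hZ x
  rw [S.nablaFundamentalForm_swap hε₁ Z, S.nablaFundamentalForm_eq hY hZ S.ξ_smooth,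
    S.nablaFundamentalForm_eq hZ hY S.ξ_smooth, S.nablaPhi_ξ hε₁, S.nablaPhi_ξ hε₁, map_neg,
    map_neg, S.g.symm x (Z x)] at h
  have h1 := hS.val_nablaξ_sub hε₀ hε₁ (Z x) (S.φ x (Y x))
  have h2 := S.val_φ hε₁ (Y x) (S.nablaξ x (Z x))
  rw [S.g.symm x (S.φ x (Y x))] at h2
  rw [S.g.symm x (Z x)] at h1
  simp only [map_add, map_smul, add_apply, smul_apply, smul_eq_mul]
  linarith

/-- Let B = φA + Aφ + 2ε₀φ², the operator representing ∇_ξ Φ. Differentiating φ² along ξ, with Aξ =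
0, gives (∇_ξ Φ)(φY, φZ) = ε₁(∇_ξ Φ)(Y, Z), that is -φBφ = ε₁B. But φBφ = ε₁B algebraically, so B =
0. -/
lemma nablaξ_φ {x : M} (v : TangentSpace I x) :
    S.nablaξ x (S.φ x v) = -S.φ x (S.nablaξ x v) - (2 * ε₀) • S.φ x (S.φ x v) := by
  have key : S.φ x (S.nablaξ x v) + S.nablaξ x (S.φ x v) + (2 * ε₀) • S.φ x (S.φ x v) = 0 := by
    refine S.g.nondegenerate x _ fun w ↦ ?_
    obtain ⟨Y, hY, rfl⟩ := exists_isSmoothVectorField_apply_eq v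
    obtain ⟨Z, hZ, rfl⟩ := exists_isSmoothVectorField_apply_eq w
    have h := S.nablaFundamentalForm_phi_phi hε₀ hε₁ S.ξ_smooth hY hZ x
    rw [hS.nablaFundamentalForm_ξ_left hε₀ hε₁ hY hZ, hS.nablaFundamentalForm_ξ_left hε₀ hε₁
      (S.isSmoothVectorField_phi hY) (S.isSmoothVectorField_phi hZ), hS.nablaξ_ξ hε₀ hε₁, phi, phi,
      ← neg_eq_iff_eq_neg.2 (S.val_φ hε₁ _ (Z x))] at h
    simp only [map_add, map_smul, hS.nablaξ_φ_φ hε₀ hε₁, φ_φ_nablaξ hε₀ hε₁, S.φ_cube hε₁,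
      map_zero, zero_apply, mul_zero, sub_zero, add_zero, add_apply,
      smul_apply, smul_eq_mul] at h ⊢
    linear_combination (-ε₁ / 2) * h - (S.g.val x (S.φ x (S.nablaξ x (Y x))) (Z x)
      + S.g.val x (S.nablaξ x (S.φ x (Y x))) (Z x)
      + 2 * ε₀ * S.g.val x (S.φ x (S.φ x (Y x))) (Z x)) * hε₁
  rw [eq_sub_iff_add_eq, eq_neg_iff_add_eq_zero, ← key]
  abel

lemma nablaPhi_ξ_left (hY : IsSmoothVectorField I Y) : S.nablaPhi S.ξ Y = 0 := by
  funext x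
  refine S.g.eq_of_forall_val fun Z hZ ↦ ?_
  rw [S.g.symm, ← S.nablaFundamentalForm_eq S.ξ_smooth hZ hY,
    hS.nablaFundamentalForm_ξ_left hε₀ hε₁ hZ hY, hS.nablaξ_φ hε₀ hε₁]
  simp only [Pi.zero_apply, map_zero, zero_apply, map_add, map_sub, map_neg, map_smul, add_apply,
    sub_apply, neg_apply, smul_apply]
  ring

lemma nabla_ξ_phi (hY : IsSmoothVectorField I Y) (x : M) :
    S.g.nabla S.ξ (S.phi Y) x = S.φ x (S.g.nabla S.ξ Y x) := by
  rw [S.nabla_phi_apply, hS.nablaPhi_ξ_left hε₀ hε₁ hY]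
  simp

/-- Torsion-freeness and ∇_ξ φ = 0 reduce h to (φA - Aφ)/2. -/
lemma h_apply (hX : IsSmoothVectorField I X) (x : M) :
    S.h X x = S.φ x (S.nablaξ x (X x)) + ε₀ • S.φ x (S.φ x (X x)) := by
  rw [h, ← S.g.nabla_sub_nabla S.ξ_smooth (S.isSmoothVectorField_phi hX),
    ← S.g.nabla_sub_nabla S.ξ_smooth hX, hS.nabla_ξ_phi hε₀ hε₁ hX, nabla_ξ_apply, nabla_ξ_apply,
    phi, hS.nablaξ_φ hε₀ hε₁, map_sub]
  module

lemma isSmoothVectorField_h (hX : IsSmoothVectorField I X) : IsSmoothVectorField I (S.h X) := by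
  have hAX := S.g.isSmoothVectorField_nabla hX S.ξ_smooth
  have h : S.h X = S.phi (S.g.nabla X S.ξ) + ε₀ • S.phi (S.phi X) :=
    funext fun y ↦ hS.h_apply hε₀ hε₁ hX y
  rw [h]
  exact (S.isSmoothVectorField_phi hAX).add
    ((S.isSmoothVectorField_phi (S.isSmoothVectorField_phi hX)).const_smul _)

/-- Take closedness at (φX, Y, Z) minus (X, φY, Z) minus (X, Y, φZ) plus ε₁ times (φX, φY, φZ).
Derivatives in the directions φY and φZ cancel, those along Y and Z reduce to terms in A, and twice
(∇_{φX} Φ)(Y, Z) - (∇_X Φ)(Y, φZ) remains. The skew part of A settles the rest. -/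
lemma phi_nablaPhi_add (hX : IsSmoothVectorField I X) (hY : IsSmoothVectorField I Y) :
    S.phi (S.nablaPhi X Y) + S.nablaPhi (S.phi X) Y
      = (fun x ↦ 2 * ε₀ * ε₁ * S.η x (Y x)) • S.phi X
        - (fun x ↦ ε₀ * ε₁ * S.g.pairing (S.g.nabla Y S.ξ) X x) • S.ξ := by
  funext x
  refine S.g.eq_of_forall_val fun Z hZ ↦ ?_
  have hX' := S.isSmoothVectorField_phi hX
  have hY' := S.isSmoothVectorField_phi hY
  have hZ' := S.isSmoothVectorField_phi hZ
  have c1 := hS.nablaFundamentalForm_cyclic hε₁ hX' hY hZ x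
  have c2 := hS.nablaFundamentalForm_cyclic hε₁ hX hY' hZ x
  have c3 := hS.nablaFundamentalForm_cyclic hε₁ hX hY hZ' x
  have c4 := hS.nablaFundamentalForm_cyclic hε₁ hX' hY' hZ' x
  rw [S.nablaFundamentalForm_phi_left hε₀ hε₁ hX hY hZ] at c2
  rw [S.nablaFundamentalForm_phi_left hε₀ hε₁ hY hZ hX] at c3
  rw [S.nablaFundamentalForm_phi_left hε₀ hε₁ hZ hX hY] at c1
  rw [S.nablaFundamentalForm_phi_phi hε₀ hε₁ hX' hY hZ,
    S.nablaFundamentalForm_phi_phi hε₀ hε₁ hY' hZ hX,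
    S.nablaFundamentalForm_phi_phi hε₀ hε₁ hZ' hX hY] at c4
  have c5 := congrArg (ε₁ * ·) c4
  simp only [← mul_add, ← mul_assoc, hε₁, one_mul, mul_zero, phi] at c5
  have s (V W : Π x : M, TangentSpace I x) := hS.val_nablaξ_sub hε₀ hε₁ (V x) (W x)
  have s' (V W : Π x : M, TangentSpace I x) := hS.val_nablaξ_sub hε₀ hε₁ (S.φ x (V x)) (S.φ x (W x))
  simp only [S.compat, S.η_φ hε₁] at s'
  have t1 := S.nablaFundamentalForm_eq hX hZ' hY x
  have t2 := S.nablaFundamentalForm_eq hX' hZ hY x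
  rw [S.nablaFundamentalForm_swap hε₁, phi, S.val_φ hε₁] at t1
  rw [S.nablaFundamentalForm_swap hε₁] at t2
  simp only [Pi.add_apply, Pi.sub_apply, Pi.smul_apply', map_add, map_sub, map_smul, add_apply,
    sub_apply, smul_apply, smul_eq_mul, S.val_ξ hε₁, PseudoMetric.pairing, nabla_ξ_apply]
  rw [S.g.symm x _ (Z x), S.g.symm x _ (Z x), ← t2, phi, ← neg_eq_iff_eq_neg.2 t1, phi,
    S.val_φ hε₁]
  linear_combination (-1 / 2) * (c1 - c2 - c3 + c5)
    + (1 / 2) * (S.η x (Y x) * s' X Z - S.η x (Z x) * s' X Y - S.η x (X x) * s' Y Z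
      - ε₁ * S.η x (Y x) * s X Z - ε₁ * S.η x (X x) * s Y Z - ε₁ * S.η x (Z x) * s X Y)
    + (ε₁ * S.η x (Z x) * S.g.val x (S.nablaξ x (Y x)) (X x)) * hε₀

/-! ### Curvature in the direction ξ. -/

lemma curvature_ξ_ξ (hX : IsSmoothVectorField I X) (x : M) :
    S.g.curvature S.ξ X S.ξ x = S.g.nabla S.ξ (S.g.nabla X S.ξ) x
      - S.nablaξ x (S.g.nabla S.ξ X x) + S.nablaξ x (S.nablaξ x (X x)) := by
  have h : S.g.nabla S.ξ S.ξ = 0 := funext fun y ↦ hS.nablaξ_ξ hε₀ hε₁ y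
  have h0 : S.g.nabla X 0 x = 0 := by simp [PseudoMetric.nabla]
  rw [PseudoMetric.curvature, h, h0, nabla_ξ_apply S (mlieBracket I S.ξ X),
    ← S.g.nabla_sub_nabla S.ξ_smooth hX, nabla_ξ_apply, map_sub]
  abel

lemma curvature_ξ_ξ_add (hX : IsSmoothVectorField I X) (x : M) :
    S.g.curvature S.ξ X S.ξ x + ε₁ • S.φ x (S.g.curvature S.ξ (S.phi X) S.ξ x)
      = (2 : ℝ) • S.φ x (S.φ x (X x)) - (2 * ε₁) • S.h (S.h X) x := by
  have hX' := S.isSmoothVectorField_phi hX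
  have hAX := S.g.isSmoothVectorField_nabla hX S.ξ_smooth
  have hAX' := S.g.isSmoothVectorField_nabla hX' S.ξ_smooth
  -- φAφ = -ε₁(A + 2ε₀φ); its ξ-derivative removes ∇_ξ A from the sum.
  have h1 : S.phi (S.g.nabla (S.phi X) S.ξ)
      = (-ε₁) • (S.g.nabla X S.ξ + (2 * ε₀) • S.phi X) := by
    funext y
    simp only [phi, nabla_ξ_apply, hS.nablaξ_φ hε₀ hε₁, map_sub, map_neg, map_smul,
      φ_φ_nablaξ hε₀ hε₁, S.φ_cube hε₁, Pi.smul_apply, Pi.add_apply]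
    module
  have h2 := hS.nabla_ξ_phi hε₀ hε₁ hAX' x
  rw [h1, S.g.nabla_const_smul _ _ (hAX.add (hX'.const_smul _)),
    S.g.nabla_add _ hAX (hX'.const_smul _), S.g.nabla_const_smul _ _ hX',
    hS.nabla_ξ_phi hε₀ hε₁ hX] at h2
  rw [hS.curvature_ξ_ξ hε₀ hε₁ hX, hS.curvature_ξ_ξ hε₀ hε₁ hX',
    hS.h_apply hε₀ hε₁ (hS.isSmoothVectorField_h hε₀ hε₁ hX), hS.h_apply hε₀ hε₁ hX,
    hS.nabla_ξ_phi hε₀ hε₁ hX, phi, map_add, map_sub, ← h2]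
  simp only [hS.nablaξ_φ hε₀ hε₁, map_add, map_sub, map_neg, map_smul,
      φ_φ_nablaξ hε₀ hε₁, S.φ_cube hε₁, smul_add, smul_sub, smul_neg, smul_smul]
  linear_combination (norm := module)
    hε₁ • ((2 : ℝ) • S.φ x (S.φ x (X x)) + S.nablaξ x (S.g.nabla S.ξ X x)
      - S.nablaξ x (S.nablaξ x (X x)) - S.g.nabla S.ξ (S.g.nabla X S.ξ) x)
    + hε₀ • ((2 * ε₁ * ε₁) • S.φ x (S.φ x (X x)))

/-- The Ricci identity for φ, simplified by ∇_ξ φ = 0. -/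
lemma curvature_ξ_phi (hX : IsSmoothVectorField I X) (hY : IsSmoothVectorField I Y) (x : M) :
    S.g.curvature S.ξ X (S.phi Y) x - S.φ x (S.g.curvature S.ξ X Y x)
      = S.g.nabla S.ξ (S.nablaPhi X Y) x - S.nablaPhi X (S.g.nabla S.ξ Y) x
        - S.nablaPhi (mlieBracket I S.ξ X) Y x := by
  have hXY := S.g.isSmoothVectorField_nabla hX hY
  have hξY := S.g.isSmoothVectorField_nabla S.ξ_smooth hY
  have h1 : S.g.nabla X (S.phi Y) = S.nablaPhi X Y + S.phi (S.g.nabla X Y) :=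
    funext fun y ↦ S.nabla_phi_apply X Y y
  have h2 : S.g.nabla S.ξ (S.phi Y) = S.phi (S.g.nabla S.ξ Y) :=
    funext fun y ↦ hS.nabla_ξ_phi hε₀ hε₁ hY y
  rw [PseudoMetric.curvature, PseudoMetric.curvature, h1, h2,
    S.g.nabla_add _ (S.isSmoothVectorField_nablaPhi hX hY) (S.isSmoothVectorField_phi hXY),
    hS.nabla_ξ_phi hε₀ hε₁ hXY, S.nabla_phi_apply X, S.nabla_phi_apply (mlieBracket I S.ξ X),
    map_sub, map_sub]
  abel

/-- The left side is ∇_ξ(T(X, Y)) - T(X, ∇_ξ Y) - T([ξ, X], Y) - 2(∇_{hX} φ)Y. In the explicit T,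
the factors φ, ξ and η are parallel along ξ, so only ∇_ξ A and, from [ξ, X] = ∇_ξ X - AX, the term
T(AX, Y) contribute. -/
lemma phi_curvature_ξ_phi_add (hX : IsSmoothVectorField I X) (hY : IsSmoothVectorField I Y)
    (x : M) :
    S.φ x (S.g.curvature S.ξ X (S.phi Y) x - S.φ x (S.g.curvature S.ξ X Y x))
      + (S.g.curvature S.ξ (S.phi X) (S.phi Y) x - S.φ x (S.g.curvature S.ξ (S.phi X) Y x))
      = (2 * ε₀ * ε₁ * S.η x (Y x)) • S.φ x (S.nablaξ x (X x))
        - (ε₀ * ε₁ * (S.g.val x (S.g.nabla S.ξ (S.g.nabla Y S.ξ) x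
            - S.nablaξ x (S.g.nabla S.ξ Y x)) (X x)
          + S.g.val x (S.nablaξ x (Y x)) (S.nablaξ x (X x)))) • S.ξ x
        - (2 : ℝ) • S.nablaPhi (S.h X) Y x := by
  have hX' := S.isSmoothVectorField_phi hX
  have hξX := S.ξ_smooth.mlieBracket hX
  have hξY := S.g.isSmoothVectorField_nabla S.ξ_smooth hY
  have hAY := S.g.isSmoothVectorField_nabla hY S.ξ_smooth
  have hQ := S.isSmoothVectorField_nablaPhi hX hY
  have hT := hS.phi_nablaPhi_add hε₀ hε₁ hX hY
  -- [ξ, φX] = φ[ξ, X] + 2hX, and ∇φ is linear in its direction.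
  have hh : (2 : ℝ) • S.nablaPhi (S.h X) Y x = S.nablaPhi (mlieBracket I S.ξ (S.phi X)) Y x
      - S.nablaPhi (S.phi (mlieBracket I S.ξ X)) Y x := by
    simp only [nablaPhi, PseudoMetric.nabla, phi, h, Pi.sub_apply, map_smul, map_sub]
    module
  have hη : ContMDiff I 𝓘(ℝ, ℝ) ∞ (fun x ↦ 2 * ε₀ * ε₁ * S.η x (Y x)) :=
    contMDiff_const.mul (S.contMDiff_η hY)
  have ha : ContMDiff I 𝓘(ℝ, ℝ) ∞ (fun x ↦ ε₀ * ε₁ * S.g.pairing (S.g.nabla Y S.ξ) X x) :=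
    contMDiff_const.mul (S.g.contMDiff_pairing hAY hX)
  have dη : mvfderiv I (fun x ↦ 2 * ε₀ * ε₁ * S.η x (Y x)) x (S.ξ x)
      = 2 * ε₀ * ε₁ * S.η x (S.g.nabla S.ξ Y x) := by
    have e : (fun x ↦ 2 * ε₀ * ε₁ * S.η x (Y x))
      = (fun _ ↦ 2 * ε₀ * ε₁) * fun x ↦ S.η x (Y x) := rfl
    rw [e, mvfderiv_mul mdifferentiableAt_const ((S.contMDiff_η hY).mdifferentiable (by simp) x)]
    simp [mvfderiv_const, S.mvfderiv_η hε₀ hε₁ S.ξ_smooth hY, hS.nablaξ_ξ hε₀ hε₁]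
  have da : mvfderiv I (fun x ↦ ε₀ * ε₁ * S.g.pairing (S.g.nabla Y S.ξ) X x) x (S.ξ x)
      = ε₀ * ε₁ * (S.g.val x (S.g.nabla S.ξ (S.g.nabla Y S.ξ) x) (X x)
        + S.g.val x (S.nablaξ x (Y x)) (S.g.nabla S.ξ X x)) := by
    have e : (fun x ↦ ε₀ * ε₁ * S.g.pairing (S.g.nabla Y S.ξ) X x)
      = (fun _ ↦ ε₀ * ε₁) * S.g.pairing (S.g.nabla Y S.ξ) X := rfl
    rw [e, mvfderiv_mul mdifferentiableAt_const
      ((S.g.contMDiff_pairing hAY hX).mdifferentiable (by simp) x)]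
    simp [mvfderiv_const, S.g.mvfderiv_pairing S.ξ_smooth hAY hX, nabla_ξ_apply]
  have h1 : S.g.nabla S.ξ (S.phi (S.nablaPhi X Y) + S.nablaPhi (S.phi X) Y) x
      = S.φ x (S.g.nabla S.ξ (S.nablaPhi X Y) x)
        + S.g.nabla S.ξ (S.nablaPhi (S.phi X) Y) x := by
    rw [S.g.nabla_add _ (S.isSmoothVectorField_phi hQ) (S.isSmoothVectorField_nablaPhi hX' hY),
      hS.nabla_ξ_phi hε₀ hε₁ hQ]
  rw [hT, S.g.nabla_sub _ (hX'.smul hη) (S.ξ_smooth.smul ha), S.g.nabla_smul _ hη hX',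
    S.g.nabla_smul _ ha S.ξ_smooth, dη, da, hS.nabla_ξ_phi hε₀ hε₁ hX, nabla_ξ_apply,
    hS.nablaξ_ξ hε₀ hε₁] at h1
  have h2 := congrFun (hS.phi_nablaPhi_add hε₀ hε₁ hX hξY) x
  have h3 := congrFun (hS.phi_nablaPhi_add hε₀ hε₁ hξX hY) x
  simp only [Pi.add_apply, Pi.sub_apply, Pi.smul_apply', PseudoMetric.pairing, phi,
    nabla_ξ_apply] at h2 h3
  rw [← S.g.nabla_sub_nabla S.ξ_smooth hX, nabla_ξ_apply] at h3
  rw [hS.curvature_ξ_phi hε₀ hε₁ hX hY, hS.curvature_ξ_phi hε₀ hε₁ hX' hY, hh, map_sub, map_sub]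
  simp only [phi, map_sub, sub_apply] at h1 h2 h3 ⊢
  linear_combination (norm := module) -h1 - h2 - h3

/-- The skew-symmetric part of `∇_ξ ∇ξ` vanishes. -/
lemma val_nabla_ξ_nablaξ_comm (hX : IsSmoothVectorField I X) (hY : IsSmoothVectorField I Y)
    (x : M) :
    S.g.val x (S.g.nabla S.ξ (S.g.nabla X S.ξ) x - S.nablaξ x (S.g.nabla S.ξ X x)) (Y x)
      = S.g.val x (S.g.nabla S.ξ (S.g.nabla Y S.ξ) x - S.nablaξ x (S.g.nabla S.ξ Y x)) (X x) := by
  have hAX := S.g.isSmoothVectorField_nabla hX S.ξ_smooth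
  have hAY := S.g.isSmoothVectorField_nabla hY S.ξ_smooth
  have hY' := S.isSmoothVectorField_phi hY
  have h : S.g.pairing (S.g.nabla X S.ξ) Y
      = S.g.pairing (S.g.nabla Y S.ξ) X + (fun _ ↦ 2 * ε₀) * S.g.pairing X (S.phi Y) :=
    funext fun y ↦ hS.val_nablaξ_sub hε₀ hε₁ (X y) (Y y)
  have d1 := (S.g.contMDiff_pairing hAY hX).mdifferentiable (by simp) x
  have d2 := (S.g.contMDiff_pairing hX hY').mdifferentiable (by simp) x
  have h1 := congrArg (fun f ↦ mvfderiv I f x (S.ξ x)) h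
  beta_reduce at h1
  rw [mvfderiv_add d1 (mdifferentiableAt_const.mul d2), mvfderiv_mul mdifferentiableAt_const d2]
    at h1
  simp only [mvfderiv_const, smul_zero, add_zero, add_apply, smul_apply, smul_eq_mul,
    S.g.mvfderiv_pairing S.ξ_smooth hAX hY, S.g.mvfderiv_pairing S.ξ_smooth hAY hX,
    S.g.mvfderiv_pairing S.ξ_smooth hX hY', hS.nabla_ξ_phi hε₀ hε₁ hY, nabla_ξ_apply, phi] at h1
  have h2 := hS.val_nablaξ_sub hε₀ hε₁ (S.g.nabla S.ξ X x) (Y x)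
  have h3 := hS.val_nablaξ_sub hε₀ hε₁ (X x) (S.g.nabla S.ξ Y x)
  simp only [map_sub, sub_apply]
  linear_combination h1 - h2 - h3

lemma curvature4_ξ_add (hX : IsSmoothVectorField I X) (hY : IsSmoothVectorField I Y)
    (hZ : IsSmoothVectorField I Z) (x : M) :
    -ε₁ * S.g.curvature4 S.ξ X Y Z x - S.g.curvature4 S.ξ X (S.phi Y) (S.phi Z) x
        + S.g.curvature4 S.ξ (S.phi X) (S.phi Y) Z x
        + S.g.curvature4 S.ξ (S.phi X) Y (S.phi Z) x
      = 2 * S.nablaFundamentalForm (S.h X) Y Z x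
        - 2 * ε₀ * S.g.val x (ε₀ • X x - ε₁ • S.h X x) (Z x) * S.η x (Y x)
        + 2 * ε₀ * S.g.val x (ε₀ • X x - ε₁ • S.h X x) (Y x) * S.η x (Z x) := by
  have hhX : IsSmoothVectorField I (S.h X) := hS.isSmoothVectorField_h hε₀ hε₁ hX
  have h1 := congrArg (fun v ↦ S.g.val x v (Z x)) (hS.phi_curvature_ξ_phi_add hε₀ hε₁ hX hY x)
  have h2 := S.nablaFundamentalForm_swap hε₁ (S.h X) Y Z x
  rw [S.nablaFundamentalForm_eq hhX hZ hY, S.g.symm] at h2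
  -- Skewness converts η(R(ξ, X)Y), left over from φ²R(ξ, X)Y, into g(R(ξ, X)ξ, Y).
  have h3 := S.g.val_curvature_add S.ξ_smooth hX hY S.ξ_smooth x
  rw [S.g.symm x _ (S.ξ x), S.val_ξ hε₁, hS.curvature_ξ_ξ hε₀ hε₁ hX, map_add, add_apply,
    hS.val_nabla_ξ_nablaξ_comm hε₀ hε₁ hX hY] at h3
  -- The difference g(A²X, Y) - g(AX, AY) left by the two ξ-parts is 2ε₀ g(AX, φY).
  have h4 := hS.val_nablaξ_sub hε₀ hε₁ (S.nablaξ x (X x)) (Y x)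
  have h5 := S.val_φ hε₁ (S.nablaξ x (X x)) (Y x)
  have h6 : S.φ x (S.nablaξ x (X x)) = S.h X x - ε₀ • S.φ x (S.φ x (X x)) := by
    rw [hS.h_apply hε₀ hε₁ hX]
    abel
  rw [h6] at h1 h5
  simp only [S.φ_sq, map_sub, map_add, map_smul, S.val_φ hε₁, S.val_ξ hε₁, add_apply, sub_apply,
    smul_apply, smul_eq_mul] at h1 h3 h5 ⊢
  simp only [PseudoMetric.curvature4, phi]
  linear_combination h1 - 2 * h2 - ε₁ * S.η x (Z x) * h3 + ε₁ * S.η x (Z x) * h4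
    + 2 * ε₀ * ε₁ * S.η x (Z x) * h5
    - ε₁ * S.η x (Z x) * (S.g.val x (S.g.nabla S.ξ (S.g.nabla Y S.ξ) x) (X x)
      - S.g.val x (S.nablaξ x (S.g.nabla S.ξ Y x)) (X x)
      + S.g.val x (S.nablaξ x (Y x)) (S.nablaξ x (X x))) * hε₀
    + 2 * ε₀ * ε₀ * (S.η x (Z x) * (S.g.val x (X x) (Y x) - ε₀ * S.η x (X x) * S.η x (Y x))
      - S.η x (Y x) * (S.g.val x (X x) (Z x) - ε₀ * S.η x (X x) * S.η x (Z x))) * hε₁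

end IsParaContactMetric

end AlmostParaContactMetric

end ParaContact

end

theorem mainTheorem7 (n : ℕ) {M : Type*} [TopologicalSpace M] [T2Space M]
    [SecondCountableTopology M] [ChartedSpace (EuclideanSpace ℝ (Fin (2 * n + 1))) M]
    [IsManifold (𝓡 (2 * n + 1)) ∞ M]
    (ε₀ ε₁ : ℝ) (hε₀ : ε₀ = 1 ∨ ε₀ = -1) (hε₁ : ε₁ = 1 ∨ ε₁ = -1)
    (S : ParaContact.AlmostParaContactMetric (𝓡 (2 * n + 1)) M ε₀ ε₁)
    (hS : S.IsParaContactMetric)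
    (X Y Z : Π x : M, TangentSpace (𝓡 (2 * n + 1)) x)
    (hX : ParaContact.IsSmoothVectorField (𝓡 (2 * n + 1)) X)
    (hY : ParaContact.IsSmoothVectorField (𝓡 (2 * n + 1)) Y)
    (hZ : ParaContact.IsSmoothVectorField (𝓡 (2 * n + 1)) Z) (x : M) :
    (S.g.curvature S.ξ X S.ξ x + ε₁ • S.φ x (S.g.curvature S.ξ (S.phi X) S.ξ x)
      = (2 : ℝ) • S.φ x (S.φ x (X x)) - (2 * ε₁) • S.h (S.h X) x) ∧
    (-ε₁ * S.g.curvature4 S.ξ X Y Z x - S.g.curvature4 S.ξ X (S.phi Y) (S.phi Z) x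
        + S.g.curvature4 S.ξ (S.phi X) (S.phi Y) Z x
        + S.g.curvature4 S.ξ (S.phi X) Y (S.phi Z) x
      = 2 * S.nablaFundamentalForm (S.h X) Y Z x
        - 2 * ε₀ * S.g.val x (ε₀ • X x - ε₁ • S.h X x) (Z x) * S.η x (Y x)
        + 2 * ε₀ * S.g.val x (ε₀ • X x - ε₁ • S.h X x) (Y x) * S.η x (Z x)) := by
  have h₀ : ε₀ * ε₀ = 1 := by rcases hε₀ with rfl | rfl <;> norm_num
  have h₁ : ε₁ * ε₁ = 1 := by rcases hε₁ with rfl | rfl <;> norm_num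
  exact ⟨hS.curvature_ξ_ξ_add h₀ h₁ hX x, hS.curvature4_ξ_add h₀ h₁ hX hY hZ x⟩
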